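/- Assume the continuum hypothesis ($\aleph_1=\mathfrak c$). A space is quasi-Lindelöf if every open cover of it has a countable subcover (no separation axiom is assumed), and Lindelöf if it is moreover regular (where regular includes $T_1$). Let $X$ be a topological space such that 1. $X$ is productively quasi-Lindelöf, that is, $X\times Y$ is quasi-Lindelöf for every Lindelöf space $Y$; and 2. every open cover $\mathcal U$ of $X^\omega$ (with the product topology) has a refinement $\mathcal W$ (a cover of $X^\omega$ each of whose members is contained in some member of $\mathcal U$) such that every point of $X^\omega$ lies in at most $\mathfrak c$ members of $\mathcal W$, and every member of $\mathcal W$ is a basic open set, that is, a set $\prod_{i\in\omega}V_i$ with each $V_i$ open in $X$ and $V_i=X$ for all but finitely many $i$. Then $X$ is powerfully quasi-Lindelöf, that is, $X^\omega$ is quasi-Lindelöf. -/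

import Mathlib

open Set
open scoped Cardinal

universe u

/-- The continuum hypothesis. -/
def ContinuumHypothesis : Prop :=
  (ℵ₁ : Cardinal.{0}) = 𝔠

/-- `𝒰` is a cover of the space `X` by open sets. -/
def IsCoverByOpens {X : Type*} [TopologicalSpace X] (𝒰 : Set (Set X)) : Prop :=
  (∀ U ∈ 𝒰, IsOpen U) ∧ ⋃₀ 𝒰 = univ

/-- Quasi-Lindelöf: every open cover has a countable subcover (no separation axiom). -/
def QuasiLindelof (X : Type*) [TopologicalSpace X] : Prop :=
  ∀ 𝒰 : Set (Set X), IsCoverByOpens 𝒰 → ∃ 𝒱 ⊆ 𝒰, 𝒱.Countable ∧ ⋃₀ 𝒱 = univ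

/-- Quasi-Lindelöf agrees with Mathlib's `LindelofSpace`, which has no separation axiom. -/
theorem quasiLindelof_iff_lindelofSpace (X : Type*) [TopologicalSpace X] :
    QuasiLindelof X ↔ LindelofSpace X := by
  constructor
  · intro h
    refine ⟨isLindelof_of_countable_subcover fun {ι} U hU hcov => ?_⟩
    obtain ⟨𝒱, hsub, hc, hV⟩ := h (range U)
      ⟨by rintro _ ⟨i, rfl⟩; exact hU i, by
        rw [sUnion_range]; exact univ_subset_iff.1 hcov⟩
    choose f hf using fun V : 𝒱 => hsub V.2
    have := hc.to_subtype
    refine ⟨range f, countable_range f, fun x _ => ?_⟩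
    obtain ⟨V, hVm, hx⟩ := (hV ▸ mem_univ x : x ∈ ⋃₀ 𝒱)
    exact mem_biUnion (mem_range_self ⟨V, hVm⟩) (by rw [hf]; exact hx)
  · rintro ⟨h⟩ 𝒰 ⟨ho, hc⟩
    obtain ⟨t, ht, htc⟩ := h.elim_countable_subcover (fun U : 𝒰 => (U : Set X))
      (fun U => ho U U.2) (by rw [← sUnion_eq_iUnion, hc])
    refine ⟨(↑) '' t, by rintro _ ⟨U, -, rfl⟩; exact U.2, ht.image _, ?_⟩
    rw [sUnion_image]
    exact univ_subset_iff.1 htc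

/-- Lindelöf: quasi-Lindelöf and regular, where regular spaces are `T₁` by convention. -/
def RegularLindelof (Y : Type*) [TopologicalSpace Y] : Prop :=
  T3Space Y ∧ QuasiLindelof Y

/-- `X × Y` is quasi-Lindelöf for every (regular) Lindelöf space `Y`. -/
def ProductivelyQuasiLindelof (X : Type u) [TopologicalSpace X] : Prop :=
  ∀ (Y : Type u) [TopologicalSpace Y], RegularLindelof Y → QuasiLindelof (X × Y)

/-- The countable power `X^ω`, with the product topology, is quasi-Lindelöf. -/
def PowerfullyQuasiLindelof (X : Type*) [TopologicalSpace X] : Prop :=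
  QuasiLindelof (ℕ → X)

/-- Basic open subsets of `X^ω`: products of open sets, all but finitely many equal to `X`. -/
def IsBasicOpen {X : Type*} [TopologicalSpace X] (W : Set (ℕ → X)) : Prop :=
  ∃ V : ℕ → Set X, (∀ i, IsOpen (V i)) ∧ {i | V i ≠ univ}.Finite ∧ W = {x | ∀ i, x i ∈ V i}

/-- `𝒲` is point-`κ`: every point lies in at most `κ` members of `𝒲`. -/
def IsPointFamily {S : Type u} (κ : Cardinal.{u}) (𝒲 : Set (Set S)) : Prop :=
  ∀ x : S, #{W : Set S // W ∈ 𝒲 ∧ x ∈ W} ≤ κ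

/-- `𝒲` is a refinement of the cover `𝒰`: a cover each of whose members lies in a
member of `𝒰`. -/
def IsRefinement {S : Type*} (𝒲 𝒰 : Set (Set S)) : Prop :=
  ⋃₀ 𝒲 = univ ∧ ∀ W ∈ 𝒲, ∃ U ∈ 𝒰, W ⊆ U

/-!
Under the continuum hypothesis the countable power of a productively quasi-Lindelöf space `X` is
quasi-Lindelöf as soon as open covers of `X^ω` have point-`𝔠` refinements by basic open sets.

*Traces of points.* Given open sets `b j`, `j : J`, of `X`, let
`N = upperTrace b` be the set of points of the cube `J → Bool` above the trace `j ↦ (x ∈ b j)` of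
some `x`. It is a regular substitute for `X`: its complement consists of the `z` for which the
`b j` with `z j = false` cover `X`, so for any space `Y` of such points the sets
`b j × {z | z j = false}` form an open cover of `X × Y`.

*Countable covers by `Gδ` sets.* Let `G β`, `β < ω₁`, be `Gδ` sets no countable subfamily of which
covers `N`, and pick `p δ ∈ N` outside `G β` for `β < δ`. If `Y`, disjoint from `N`, is such that
`Y` with the `p δ` added as isolated points is Lindelöf, then its product with `X` is not Lindelöf:
the sets above together with the uncountably many slices over the isolated points form a cover
without countable subcover (`ProductivelyQuasiLindelof.exists_countable_cover`). The space is
Lindelöf as soon as `Y` is Lindelöf inside each `G β` and every nonempty compact set missing `Y`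
has a nonempty relatively open part inside some `G β` (`isLindelof_concentrated`).

For countable `J` one takes `Y = Nᶜ` and the `Gδ` sets inside `N`, and finds that `N` is
`σ`-compact (`exists_upperTrace_eq_sUnion`). For `#J ≤ ℵ₁`, let the `G β` be such that each compact
subset of `N` lies in one of them. Fix countable `C δ ⊆ J`, increasing to `J`, and let `Y` consist
of the points that some `C δ` certifies to lie outside `N` and that avoid all `G β` with `β < δ`.
If a compact `K` missing `Y` had no relatively open part inside any `G β`, then every relatively
open part of `K` would contain points outside `N`; at a suitable limit stage `δ` the points of `K`
outside `N` by virtue of `C δ` would be dense in the projection of `K` to `C δ → Bool`. They form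
a `Gδ` set there by `σ`-compactness, so by Baire one of them avoids the countably many nowhere
dense `G β`, `β < δ`, and belongs to `Y`. Hence countably many `G β` cover `N`
(`exists_countable_avoid_cover`, a form of a theorem of Alster).

*Powers.* If a cover of `X^ω` by at most `𝔠 = ℵ₁` basic open sets has no countable subcover, apply
this with `b` the family of all factors to choose compact sets `K 0, K 1, … ⊆ N` such that no `Gδ`
neighbourhood of `K 0 × ⋯ × K (n - 1)` gives a countably covered part of `X^ω`. Compactness of
`∏ K i` then gives a contradiction (`exists_countable_subcover_pi`).

*Reduction to small covers.* Closing off under `𝔠` many `ω`-ary operations yields `Y ⊆ X` such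
that at most `𝔠` members of a point-`𝔠` family `𝒲` meet `Y^ω` and no countably many of these cover
`Y^ω` (`exists_small_uncovered`). As the members are basic open sets, those meeting `Y^ω` cover the
power of the closure of `Y`, which is again productively quasi-Lindelöf.
-/

/-! ### Lindelöf test spaces -/

/-- The points of the cube `J → Bool` at which finitely many coordinates have prescribed values. -/
def cyl {J : Type*} (a : Finset (J × Bool)) : Set (J → Bool) :=
  {z | ∀ p ∈ a, z p.1 = p.2}

/-- The closed set obtained from the cube by removing the cylinders coded by `A`.
For countable `A` it is a closed `Gδ` set depending on countably many coordinates. -/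
def avoid {J : Type*} (A : Set (Finset (J × Bool))) : Set (J → Bool) :=
  {z | ∀ a ∈ A, z ∉ cyl a}

/-- The points of the cube `J → Bool` lying above the trace `j ↦ (x ∈ b j)` of some `x : X`.
A point `z` is outside this set exactly when the sets `b j` with `z j = false` cover `X`. -/
def upperTrace {X J : Type*} (b : J → Set X) : Set (J → Bool) :=
  {z | ∃ x, ∀ j, x ∈ b j → z j = true}

theorem isClopen_cyl {J : Type*} (a : Finset (J × Bool)) : IsClopen (cyl a) := by
  have : cyl a = ⋂ p ∈ a, {z : J → Bool | z p.1 = p.2} := by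
    ext z; simp [cyl]
  rw [this]
  refine a.finite_toSet.isClopen_biInter fun p _ => ?_
  exact (isClopen_discrete {p.2}).preimage (continuous_apply p.1)

theorem exists_cyl_subset {J : Type*} {U : Set (J → Bool)} (hU : IsOpen U) {z : J → Bool}
    (hz : z ∈ U) : ∃ a : Finset (J × Bool), z ∈ cyl a ∧ cyl a ⊆ U := by
  classical
  obtain ⟨s, u, hu, hsub⟩ := isOpen_pi_iff.1 hU z hz
  refine ⟨s.image fun j => (j, z j), ?_, fun w hw => hsub fun j hj => ?_⟩
  · intro p hp
    obtain ⟨j, -, rfl⟩ := Finset.mem_image.1 hp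
    rfl
  · have : w j = z j := hw (j, z j) (Finset.mem_image_of_mem _ hj)
    rw [this]
    exact (hu j hj).2

theorem isClosed_avoid {J : Type*} (A : Set (Finset (J × Bool))) : IsClosed (avoid A) := by
  have : avoid A = ⋂ a ∈ A, (cyl a)ᶜ := by
    ext z; simp [avoid]
  rw [this]
  exact isClosed_biInter fun a _ => (isClopen_cyl a).compl.isClosed

theorem isGδ_avoid {J : Type*} {A : Set (Finset (J × Bool))} (hA : A.Countable) :
    IsGδ (avoid A) := by
  have : avoid A = ⋂ a ∈ A, (cyl a)ᶜ := by
    ext z; simp [avoid]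
  rw [this]
  exact IsGδ.biInter_of_isOpen hA fun a _ => (isClopen_cyl a).compl.isOpen

/-- Suppose that the initial segments of `Ω` are countable, that `Y` is Lindelöf inside each of the
`Gδ` sets `G β`, and that every nonempty compact set missing `Y` has a nonempty
relatively open part inside some `G β`. Then adding to `Y` isolated points `p δ` with `p δ ∉ G β`
for `β < δ` produces a Lindelöf space. The second coordinate isolates the new points. -/
theorem isLindelof_concentrated {J Ω : Type u} [LinearOrder Ω]
    (hΩ : ∀ δ : Ω, (Iic δ).Countable) (G : Ω → Set (J → Bool)) (hG : ∀ β, IsGδ (G β))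
    (Y : Set (J → Bool)) (hL : ∀ β, ∃ L, IsLindelof L ∧ Y ∩ G β ⊆ L ∧ L ⊆ Y)
    (hK : ∀ K : Set (J → Bool), IsCompact K → K.Nonempty → Disjoint K Y →
      ∃ O β, IsOpen O ∧ (O ∩ K).Nonempty ∧ O ∩ K ⊆ G β)
    (p : Ω → J → Bool) (hp : ∀ β δ, β < δ → p δ ∉ G β) :
    IsLindelof ({y : (J → Bool) × (Ω → Bool) | y.1 ∈ Y ∧ y.2 = fun _ => false} ∪
      {y | ∃ δ, y = (p δ, fun η => decide (η = δ))}) := by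
  classical
  set T := {y : (J → Bool) × (Ω → Bool) | y.1 ∈ Y ∧ y.2 = fun _ => false} ∪
      {y | ∃ δ, y = (p δ, fun η => decide (η = δ))} with hT
  refine isLindelof_of_countable_subcover fun {ι} U hU hcov => ?_
  -- `Cov S`: the part of `T` above `S` is covered by countably many of the given sets.
  let Cov : Set (J → Bool) → Prop := fun S =>
    ∃ t : Set ι, t.Countable ∧ T ∩ {y | y.1 ∈ S} ⊆ ⋃ i ∈ t, U i
  have cov_mono : ∀ {S S'}, S ⊆ S' → Cov S' → Cov S := by
    rintro S S' h ⟨t, ht, h'⟩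
    exact ⟨t, ht, fun y hy => h' ⟨hy.1, h hy.2⟩⟩
  have cov_iUnion : ∀ {α : Type u} (D : Set α) (S : α → Set (J → Bool)), D.Countable →
      (∀ d ∈ D, Cov (S d)) → Cov (⋃ d ∈ D, S d) := by
    intro α D S hD h
    choose! t ht h' using h
    refine ⟨⋃ d ∈ D, t d, hD.biUnion ht, ?_⟩
    rintro y ⟨hyT, hy⟩
    obtain ⟨d, hd, hyd⟩ := mem_iUnion₂.1 hy
    obtain ⟨i, hi, hyi⟩ := mem_iUnion₂.1 (h' d hd ⟨hyT, hyd⟩)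
    exact mem_iUnion₂.2 ⟨i, mem_iUnion₂.2 ⟨d, hd, hi⟩, hyi⟩
  have cov_union : ∀ {S S'}, Cov S → Cov S' → Cov (S ∪ S') := by
    rintro S S' ⟨t, ht, h⟩ ⟨t', ht', h'⟩
    refine ⟨t ∪ t', ht.union ht', ?_⟩
    rintro y ⟨hyT, hy | hy⟩
    · obtain ⟨i, hi, hyi⟩ := mem_iUnion₂.1 (h ⟨hyT, hy⟩)
      exact mem_iUnion₂.2 ⟨i, Or.inl hi, hyi⟩
    · obtain ⟨i, hi, hyi⟩ := mem_iUnion₂.1 (h' ⟨hyT, hy⟩)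
      exact mem_iUnion₂.2 ⟨i, Or.inr hi, hyi⟩
  -- Countably many of the isolated points never matter.
  have cov_of : ∀ (S : Set (J → Bool)) (t : Set ι) (D : Set Ω), t.Countable → D.Countable →
      (∀ z ∈ S, z ∈ Y → (z, fun _ => false) ∈ ⋃ i ∈ t, U i) →
      (∀ δ, δ ∉ D → p δ ∈ S → (p δ, fun η => decide (η = δ)) ∈ ⋃ i ∈ t, U i) → Cov S := by
    intro S t D ht hD h1 h2
    have h3 : ∀ δ, ∃ i, (p δ, fun η => decide (η = δ)) ∈ U i := fun δ =>
      mem_iUnion.1 (hcov (Or.inr ⟨δ, rfl⟩))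
    choose f hf using h3
    refine ⟨t ∪ f '' D, ht.union (hD.image f), ?_⟩
    rintro ⟨z, w⟩ ⟨⟨hz, hw⟩ | ⟨δ, hδ⟩, hy⟩
    · simp only at hz hw hy
      subst hw
      obtain ⟨i, hi, hyi⟩ := mem_iUnion₂.1 (h1 z hy hz)
      exact mem_iUnion₂.2 ⟨i, Or.inl hi, hyi⟩
    · rw [hδ] at hy ⊢
      by_cases hd : δ ∈ D
      · exact mem_iUnion₂.2 ⟨f δ, Or.inr ⟨δ, hd, rfl⟩, hf δ⟩
      · obtain ⟨i, hi, hyi⟩ := mem_iUnion₂.1 (h2 δ hd hy)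
        exact mem_iUnion₂.2 ⟨i, Or.inl hi, hyi⟩
  have cov_nhd : ∀ z ∈ Y, ∃ O, IsOpen O ∧ z ∈ O ∧ Cov O := by
    intro z hz
    obtain ⟨i, hi⟩ := mem_iUnion.1 (hcov (Or.inl ⟨hz, rfl⟩ : ((z, fun _ => false) ∈ T)))
    obtain ⟨O, O', hO, hO', hzO, h0, hsub⟩ := isOpen_prod_iff.1 (hU i) _ _ hi
    obtain ⟨s, u, hu, hs⟩ := isOpen_pi_iff.1 hO' _ h0
    refine ⟨O, hO, hzO, cov_of O {i} s (countable_singleton i) s.countable_toSet ?_ ?_⟩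
    · intro w hw _
      exact mem_iUnion₂.2 ⟨i, rfl, hsub ⟨hw, h0⟩⟩
    · intro δ hδ hw
      refine mem_iUnion₂.2 ⟨i, rfl, hsub ⟨hw, hs fun η hη => ?_⟩⟩
      have : η ≠ δ := by rintro rfl; exact hδ hη
      simpa [this] using (hu η hη).2
  have cov_G : ∀ β, Cov (G β) := by
    intro β
    obtain ⟨L, hLL, hYL, hLY⟩ := hL β
    choose! O hO hzO hcO using cov_nhd
    obtain ⟨D, hD, hDL, hLD⟩ := hLL.elim_nhds_subcover O fun z hz =>
      (hO z (hLY hz)).mem_nhds (hzO z (hLY hz))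
    obtain ⟨t, ht, htL⟩ := cov_iUnion D O hD fun d hd => hcO d (hLY (hDL d hd))
    refine cov_of _ t (Iic β) ht (hΩ β) ?_ ?_
    · intro z hz hzY
      exact htL ⟨Or.inl ⟨hzY, rfl⟩, hLD (hYL ⟨hzY, hz⟩)⟩
    · intro δ hδ hpδ
      exact absurd hpδ (hp β δ (not_le.1 hδ))
  -- The points without a good neighbourhood. A nonempty `K` would have a part inside some `G β`,
  -- and the rest of a neighbourhood of that part, up to `G β`, is a countable union of compact sets
  -- missing `K`.
  let K : Set (J → Bool) := {z | ∀ O, IsOpen O → z ∈ O → ¬ Cov O}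
  have hKc : ∀ C : Set (J → Bool), IsClosed C → Disjoint C K → Cov C := by
    intro C hC hCK
    have : ∀ z ∈ C, ∃ O, IsOpen O ∧ z ∈ O ∧ Cov O := by
      intro z hz
      have := disjoint_left.1 hCK hz
      simpa only [K, mem_ofPred_eq, not_forall, not_not, exists_prop] using this
    choose! O hO hzO hcO using this
    obtain ⟨D, hDC, hCD⟩ := hC.isCompact.elim_nhds_subcover O fun z hz =>
      (hO z hz).mem_nhds (hzO z hz)
    exact cov_mono hCD (cov_iUnion (D : Set (J → Bool)) O D.countable_toSet
      fun d hd => hcO d (hDC d hd))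
  have hKe : ¬ K.Nonempty := by
    intro hne
    have hKcl : IsClosed K := by
      rw [← isOpen_compl_iff, isOpen_iff_forall_mem_open]
      intro z hz
      simp only [K, mem_compl_iff, mem_ofPred_eq, not_forall, not_not] at hz
      obtain ⟨O, hO, hzO, hc⟩ := hz
      exact ⟨O, fun w hw hwK => hwK O hO hw hc, hO, hzO⟩
    have hdis : Disjoint K Y := by
      refine disjoint_left.2 fun z hzK hzY => ?_
      obtain ⟨O, hO, hzO, hc⟩ := cov_nhd z hzY
      exact hzK O hO hzO hc
    obtain ⟨O, β, hO, ⟨z, hzO, hzK⟩, hsub⟩ := hK K hKcl.isCompact hne hdis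
    obtain ⟨a, hza, haO⟩ := exists_cyl_subset hO hzO
    obtain ⟨Q, hQ, hGQ⟩ := (isGδ_iff_eq_iInter_nat).1 (hG β)
    have h1 : Cov (⋃ n ∈ (univ : Set (ULift.{u} ℕ)), cyl a \ Q n.down) := by
      refine cov_iUnion _ _ (to_countable _) fun n _ => hKc _ ?_ ?_
      · exact (isClopen_cyl a).isClosed.sdiff (hQ n.down)
      · refine disjoint_left.2 fun w hw hwK => hw.2 ?_
        have := hsub ⟨haO hw.1, hwK⟩
        rw [hGQ] at this
        exact mem_iInter.1 this n.down
    refine hzK (cyl a) (isClopen_cyl a).isOpen hza (cov_mono ?_ (cov_union (cov_G β) h1))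
    intro w hw
    by_cases hwG : w ∈ G β
    · exact Or.inl hwG
    · rw [hGQ, mem_iInter, not_forall] at hwG
      obtain ⟨n, hn⟩ := hwG
      exact Or.inr (mem_iUnion₂.2 ⟨⟨n⟩, trivial, hw, hn⟩)
  obtain ⟨t, ht, h⟩ := hKc univ isClosed_univ
    (by rw [not_nonempty_iff_eq_empty.1 hKe]; exact disjoint_empty _)
  exact ⟨t, ht, fun y hy => h ⟨hy, trivial⟩⟩

/-- A product with the space of `isLindelof_concentrated` shows that countably many of the sets
`G β` cover `upperTrace b`: otherwise the points `p δ` could be chosen in `upperTrace b`. -/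
theorem ProductivelyQuasiLindelof.exists_countable_cover {X : Type u} [TopologicalSpace X]
    (hX : ProductivelyQuasiLindelof X) {J Ω : Type u} [LinearOrder Ω] [Uncountable Ω]
    (hΩ : ∀ δ : Ω, (Iic δ).Countable) (b : J → Set X) (hb : ∀ j, IsOpen (b j))
    (G : Ω → Set (J → Bool)) (hG : ∀ β, IsGδ (G β))
    (Y : Set (J → Bool)) (hY : Disjoint Y (upperTrace b))
    (hL : ∀ β, ∃ L, IsLindelof L ∧ Y ∩ G β ⊆ L ∧ L ⊆ Y)
    (hK : ∀ K : Set (J → Bool), IsCompact K → K.Nonempty → Disjoint K Y →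
      ∃ O β, IsOpen O ∧ (O ∩ K).Nonempty ∧ O ∩ K ⊆ G β) :
    ∃ D : Set Ω, D.Countable ∧ upperTrace b ⊆ ⋃ β ∈ D, G β := by
  classical
  by_contra! hcon
  have h1 : ∀ δ : Ω, ∃ z ∈ upperTrace b, ∀ β < δ, z ∉ G β := by
    intro δ
    obtain ⟨z, hz, hz'⟩ := not_subset.1 (hcon (Iio δ) ((hΩ δ).mono Iio_subset_Iic_self))
    refine ⟨z, hz, fun β hβ hzβ => hz' (mem_iUnion₂.2 ⟨β, hβ, hzβ⟩)⟩
  choose p hpN hp using h1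
  choose x hx using hpN
  have hT := isLindelof_concentrated hΩ G hG Y hL hK p fun β δ h => hp δ β h
  set T := {y : (J → Bool) × (Ω → Bool) | y.1 ∈ Y ∧ y.2 = fun _ => false} ∪
      {y | ∃ δ, y = (p δ, fun η => decide (η = δ))} with hTdef
  have hTR : RegularLindelof T :=
    ⟨inferInstance, (quasiLindelof_iff_lindelofSpace _).2
      (isLindelof_iff_lindelofSpace.1 hT)⟩
  have hprod := (quasiLindelof_iff_lindelofSpace _).1 (hX T hTR)
  let V : J ⊕ Ω → Set (X × T) := Sum.elim (fun j => {q | q.1 ∈ b j ∧ q.2.1.1 j = false})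
    (fun δ => {q | q.2.1.2 δ = true})
  obtain ⟨t, ht, htc⟩ := hprod.isLindelof_univ.elim_countable_subcover V
    (by
      rintro (j | δ)
      · refine ((hb j).preimage continuous_fst).inter ?_
        exact (isOpen_discrete {false}).preimage (f := fun q : X × T => q.2.1.1 j) (by fun_prop)
      · exact (isOpen_discrete {true}).preimage (f := fun q : X × T => q.2.1.2 δ) (by fun_prop))
    (by
      rintro ⟨x, ⟨z, w⟩, ⟨hz, hw⟩ | ⟨δ, hδ⟩⟩ -
      · have : z ∉ upperTrace b := disjoint_left.1 hY hz
        simp only [upperTrace, mem_ofPred_eq, not_exists, not_forall] at this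
        obtain ⟨j, hj, hzj⟩ := this x
        exact mem_iUnion.2 ⟨Sum.inl j, hj, by simpa using hzj⟩
      · refine mem_iUnion.2 ⟨Sum.inr δ, ?_⟩
        simp only [Prod.mk.injEq] at hδ
        simp [V, hδ.2])
  have hne : ∃ δ : Ω, Sum.inr δ ∉ t := by
    by_contra! hall
    exact not_countable_univ ((ht.preimage Sum.inr_injective).mono fun δ _ => hall δ)
  obtain ⟨δ, hδ⟩ := hne
  obtain ⟨i, hi, hmem⟩ := mem_iUnion₂.1
    (htc (mem_univ (x δ, ⟨(p δ, fun η => decide (η = δ)), Or.inr ⟨δ, rfl⟩⟩)))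
  rcases i with j | η
  · have h1 := hx δ j hmem.1
    have h2 : p δ j = false := hmem.2
    simp [h1] at h2
  · have : η = δ := by simpa [V] using hmem
    exact hδ (this ▸ hi)

/-! ### The cube over countably many coordinates -/

theorem ContinuumHypothesis.aleph_one_eq (h : ContinuumHypothesis) :
    (ℵ₁ : Cardinal.{u}) = 𝔠 := by
  have := congrArg Cardinal.lift.{u} h
  simpa using this

/-- The well-ordered set of countable ordinals. -/
abbrev CountableOrdinals : Type u := (Cardinal.ord (ℵ₁ : Cardinal.{u})).ToType

theorem countable_Iic_countableOrdinals (δ : CountableOrdinals.{u}) : (Iic δ).Countable := by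
  have h : (Iio δ).Countable := by
    rw [← Cardinal.le_aleph0_iff_set_countable, ← Order.lt_succ_iff]
    simpa using Cardinal.mk_Iio_lt δ (by simp)
  rw [← Iio_insert]
  exact h.insert δ

instance : Uncountable CountableOrdinals.{u} := by
  rw [← Cardinal.aleph0_lt_mk_iff, Cardinal.mk_ord_toType]
  exact Cardinal.aleph0_lt_aleph_one

theorem exists_forall_lt_countableOrdinals {D : Set CountableOrdinals.{u}} (hD : D.Countable) :
    ∃ δ, ∀ d ∈ D, d < δ := by
  have h : (⋃ d ∈ D, Iic d).Countable := hD.biUnion fun d _ => countable_Iic_countableOrdinals d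
  obtain ⟨δ, hδ⟩ : ∃ δ, δ ∉ ⋃ d ∈ D, Iic d := by
    by_contra! hall
    exact not_countable_univ (h.mono fun δ _ => hall δ)
  exact ⟨δ, fun d hd => not_le.1 fun hle => hδ (mem_iUnion₂.2 ⟨d, hd, hle⟩)⟩

theorem ProductivelyQuasiLindelof.lindelofSpace {X : Type u} [TopologicalSpace X]
    (hX : ProductivelyQuasiLindelof X) : LindelofSpace X := by
  have h := (quasiLindelof_iff_lindelofSpace _).1 (hX PUnit.{u + 1}
    ⟨inferInstance, (quasiLindelof_iff_lindelofSpace _).2 inferInstance⟩)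
  have := h.isLindelof_univ.image (continuous_fst (X := X) (Y := PUnit.{u + 1}))
  rw [image_univ, Prod.range_fst] at this
  exact ⟨this⟩

theorem isLindelof_preimage_of_compactSpace {Z W : Type*} [TopologicalSpace Z] [CompactSpace Z]
    [TopologicalSpace W] [T2Space W] [HereditarilyLindelofSpace W] {f : Z → W}
    (hf : Continuous f) (P : Set W) : IsLindelof (f ⁻¹' P) := by
  refine isLindelof_of_countable_subcover fun {ι} U hU hcov => ?_
  have h : ∀ p ∈ P, ∃ t : Finset ι, f ⁻¹' {p} ⊆ ⋃ i ∈ t, U i := fun p hp =>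
    (isClosed_singleton.preimage hf).isCompact.elim_finite_subcover U hU
      ((preimage_mono (singleton_subset_iff.2 hp)).trans hcov)
  choose! t ht using h
  let O : W → Set W := fun p => (f '' (⋃ i ∈ t p, U i)ᶜ)ᶜ
  have hO : ∀ p, IsOpen (O p) := fun p =>
    (hf.isClosedMap _ (isOpen_biUnion fun i _ => hU i).isClosed_compl).isOpen_compl
  have hpO : ∀ p ∈ P, p ∈ O p := by
    rintro p hp ⟨z, hz, rfl⟩
    exact hz (ht _ hp rfl)
  obtain ⟨D, hD, hDP, hPD⟩ := (HereditarilyLindelofSpace.isLindelof P).elim_nhds_subcover O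
    fun p hp => (hO p).mem_nhds (hpO p hp)
  refine ⟨⋃ p ∈ D, (t p : Set ι), hD.biUnion fun p _ => (t p).countable_toSet, fun z hz => ?_⟩
  obtain ⟨p, hp, hzp⟩ := mem_iUnion₂.1 (hPD hz)
  by_contra hcon
  refine hzp ⟨z, fun hz' => hcon ?_, rfl⟩
  obtain ⟨i, hi, hzi⟩ := mem_iUnion₂.1 hz'
  exact mem_iUnion₂.2 ⟨i, mem_iUnion₂.2 ⟨p, hp, hi⟩, hzi⟩

/-- The Baire category theorem for a compact set, in terms of closed sets that are nowhere dense
in it. -/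
theorem IsCompact.exists_notMem_of_countable {W : Type*} [TopologicalSpace W] [T2Space W]
    {K : Set W} (hK : IsCompact K) (hne : K.Nonempty) {S : Set (Set W)} (hS : S.Countable)
    (hcl : ∀ F ∈ S, IsClosed F)
    (hd : ∀ F ∈ S, ∀ O, IsOpen O → (O ∩ K).Nonempty → ∃ p ∈ O ∩ K, p ∉ F) :
    ∃ p ∈ K, ∀ F ∈ S, p ∉ F := by
  have := isCompact_iff_compactSpace.1 hK
  have : Nonempty K := hne.to_subtype
  have h := dense_biInter_of_isOpen (X := K) (f := fun F : Set W => ((↑) ⁻¹' F : Set K)ᶜ)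
    (S := S) (fun F hF => ((hcl F hF).preimage continuous_subtype_val).isOpen_compl) hS
    (by
      intro F hF
      rw [dense_iff_inter_open]
      rintro _ ⟨O, hO, rfl⟩ ⟨q, hq⟩
      obtain ⟨p, hp, hpF⟩ := hd F hF O hO ⟨q, hq, q.2⟩
      exact ⟨⟨p, hp.2⟩, hp.1, hpF⟩)
  obtain ⟨p, hp⟩ := h.nonempty
  exact ⟨p, p.2, fun F hF => mem_iInter₂.1 hp F hF⟩

/-- Any set of size at most `ℵ₁` is indexed by the countable ordinals. -/
theorem exists_range_countableOrdinals {α : Type u} {S : Set α} (hne : S.Nonempty)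
    (hS : #S ≤ ℵ₁) : ∃ g : CountableOrdinals.{u} → α, range g = S := by
  rw [← Cardinal.mk_ord_toType ℵ₁] at hS
  obtain ⟨f⟩ := hS
  have := hne.to_subtype
  refine ⟨fun δ => (Function.invFun f δ : S), ?_⟩
  have := (Function.invFun_surjective f.injective).range_eq
  rw [range_comp' Subtype.val, this]
  simp

/-- Under the continuum hypothesis, `upperTrace b` is `σ`-compact when `b` is countable. -/
theorem ProductivelyQuasiLindelof.exists_upperTrace_eq_sUnion (hCH : ContinuumHypothesis)
    {X : Type u} [TopologicalSpace X]
    (hX : ProductivelyQuasiLindelof X) {J : Type u} [Countable J] (b : J → Set X)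
    (hb : ∀ j, IsOpen (b j)) :
    ∃ S : Set (Set (J → Bool)), S.Countable ∧ (∀ F ∈ S, IsClosed F) ∧
      upperTrace b = ⋃₀ S := by
  let 𝒢 : Set (Set (Finset (J × Bool))) := {A | avoid A ⊆ upperTrace b}
  obtain ⟨g, hg⟩ := exists_range_countableOrdinals (S := 𝒢) ⟨univ, fun z hz =>
    absurd (by simp [cyl]) (hz ∅ trivial)⟩ (by
      refine (Cardinal.mk_set_le _).trans ?_
      rw [hCH.aleph_one_eq, Cardinal.mk_set, ← Cardinal.two_power_aleph0]
      exact Cardinal.power_le_power_left two_ne_zero Cardinal.mk_le_aleph0)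
  have hg' : ∀ δ, avoid (g δ) ⊆ upperTrace b := fun δ => by
    have : g δ ∈ 𝒢 := hg ▸ mem_range_self δ
    exact this
  obtain ⟨D, hD, hDc⟩ := hX.exists_countable_cover countable_Iic_countableOrdinals b hb
    (fun δ => avoid (g δ)) (fun δ => isGδ_avoid (to_countable _)) (upperTrace b)ᶜ
    disjoint_compl_left
    (fun β => ⟨(upperTrace b)ᶜ, HereditarilyLindelofSpace.isLindelof _, inter_subset_left,
      subset_rfl⟩)
    (by
      intro K hK hne hKY
      have hKs : K ⊆ upperTrace b := by
        simpa using hKY.subset_compl_right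
      have hAK : avoid {a | Disjoint (cyl a) K} ⊆ K := by
        intro z hz
        by_contra hzK
        obtain ⟨a, hza, ha⟩ := exists_cyl_subset hK.isClosed.isOpen_compl hzK
        exact hz a (disjoint_left.2 ha) hza
      obtain ⟨β, hβ⟩ : {a | Disjoint (cyl a) K} ∈ range g := by
        rw [hg]; exact hAK.trans hKs
      refine ⟨univ, β, isOpen_univ, by simpa using hne, fun z hz a ha hza => ?_⟩
      rw [hβ] at ha
      exact disjoint_left.1 ha hza hz.2)
  refine ⟨(fun δ => avoid (g δ)) '' D, hD.image _, ?_, subset_antisymm ?_ ?_⟩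
  · rintro _ ⟨δ, -, rfl⟩
    exact isClosed_avoid _
  · rwa [sUnion_image]
  · rw [sUnion_image]
    exact iUnion₂_subset fun δ _ => hg' δ

theorem restrict_mem_upperTrace {X J : Type*} {b : J → Set X} {z : J → Bool} (C : Set J)
    (hz : z ∈ upperTrace b) : C.domRestrict z ∈ upperTrace fun j : C => b j := by
  obtain ⟨x, hx⟩ := hz
  exact ⟨x, fun j hj => hx j hj⟩

theorem restrict_mem_upperTrace_mono {X J : Type*} {b : J → Set X} {z : J → Bool} {C C' : Set J}
    (h : C ⊆ C') (hz : C'.domRestrict z ∈ upperTrace fun j : C' => b j) :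
    C.domRestrict z ∈ upperTrace fun j : C => b j := by
  obtain ⟨x, hx⟩ := hz
  exact ⟨x, fun j hj => hx ⟨j, h j.2⟩ hj⟩

theorem exists_countable_restrict_notMem_upperTrace {X J : Type*} [TopologicalSpace X]
    [LindelofSpace X] {b : J → Set X} (hb : ∀ j, IsOpen (b j)) {z : J → Bool}
    (hz : z ∉ upperTrace b) :
    ∃ C : Set J, C.Countable ∧ C.domRestrict z ∉ upperTrace fun j : C => b j := by
  obtain ⟨t, ht, htc⟩ := isLindelof_univ.elim_countable_subcover
    (fun j : {j // z j = false} => b j) (fun j => hb j) (by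
      intro x _
      simp only [upperTrace, mem_ofPred_eq, not_exists, not_forall] at hz
      obtain ⟨j, hj, hzj⟩ := hz x
      exact mem_iUnion.2 ⟨⟨j, by simpa using hzj⟩, hj⟩)
  refine ⟨(↑) '' t, ht.image _, ?_⟩
  rintro ⟨x, hx⟩
  obtain ⟨j, hj, hxj⟩ := mem_iUnion₂.1 (htc (mem_univ x))
  have h1 : z j = true := hx ⟨j, j, hj, rfl⟩ hxj
  simp [j.2] at h1

theorem mem_avoid_of_restrict_eq {J : Type*} {A : Set (Finset (J × Bool))} {C : Set J}
    (hC : ∀ a ∈ A, ∀ p ∈ a, p.1 ∈ C) {z w : J → Bool} (h : C.domRestrict z = C.domRestrict w)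
    (hz : z ∈ avoid A) : w ∈ avoid A := by
  intro a ha hwa
  refine hz a ha fun p hp => ?_
  rw [← hwa p hp]
  exact congrFun h ⟨p.1, hC a ha p hp⟩

theorem exists_cyl_subset_preimage_restrict {J : Type*} {C : Set J} {U : Set (C → Bool)}
    (hU : IsOpen U) {z : J → Bool} (hz : C.domRestrict z ∈ U) :
    ∃ a : Finset (J × Bool), (∀ p ∈ a, p.1 ∈ C) ∧ z ∈ cyl a ∧ cyl a ⊆ C.domRestrict ⁻¹' U := by
  classical
  obtain ⟨a, ha, haU⟩ := exists_cyl_subset hU hz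
  refine ⟨a.image fun p => (p.1.1, p.2), ?_, ?_, fun w hw => haU fun p hp => ?_⟩
  · intro p hp
    obtain ⟨q, -, rfl⟩ := Finset.mem_image.1 hp
    exact q.1.2
  · intro p hp
    obtain ⟨q, hq, rfl⟩ := Finset.mem_image.1 hp
    exact ha q hq
  · exact hw (p.1.1, p.2) (Finset.mem_image_of_mem _ hp)

theorem mk_countable_codes_le (hCH : ContinuumHypothesis) {J : Type u} (hJ : #J ≤ ℵ₁) :
    #{A : Set (Finset (J × Bool)) // A.Countable} ≤ ℵ₁ := by
  have h1 : #(Finset (J × Bool)) ≤ 𝔠 := by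
    refine (Cardinal.mk_le_of_injective (f := Finset.toList) fun s t h => ?_).trans ?_
    · rw [← Finset.val_inj, ← Finset.coe_toList, h, Finset.coe_toList]
    refine (Cardinal.mk_list_le_max _).trans (max_le Cardinal.aleph0_le_continuum ?_)
    rw [Cardinal.mk_prod, Cardinal.lift_uzero]
    refine (mul_le_mul' (hJ.trans_eq hCH.aleph_one_eq) (?_ : _ ≤ 𝔠)).trans_eq
      Cardinal.continuum_mul_self
    simpa using (Cardinal.nat_lt_continuum 2).le
  have h2 := Cardinal.mk_bounded_set_le (Finset (J × Bool)) ℵ₀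
  simp only [Cardinal.le_aleph0_iff_set_countable] at h2
  rw [hCH.aleph_one_eq]
  refine h2.trans ((Cardinal.power_le_power_right
    (max_le h1 Cardinal.aleph0_le_continuum)).trans_eq Cardinal.continuum_power_aleph0)

/-! ### Countable covers by `Gδ` sets for `ℵ₁` coordinates -/

/-- Under the continuum hypothesis, if every compact subset of `upperTrace b` lies in one of the
`Gδ` sets coded by `𝒢`, then countably many of these cover `upperTrace b`. -/
theorem ProductivelyQuasiLindelof.exists_countable_avoid_cover (hCH : ContinuumHypothesis)
    {X : Type u} [TopologicalSpace X] (hX : ProductivelyQuasiLindelof X) {J : Type u}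
    (hJ : #J ≤ ℵ₁) (b : J → Set X) (hb : ∀ j, IsOpen (b j))
    (𝒢 : Set (Set (Finset (J × Bool)))) (hc : ∀ A ∈ 𝒢, A.Countable)
    (h𝒢 : ∀ K, IsCompact K → K ⊆ upperTrace b → ∃ A ∈ 𝒢, K ⊆ avoid A) :
    ∃ D ⊆ 𝒢, D.Countable ∧ upperTrace b ⊆ ⋃ A ∈ D, avoid A := by
  have := hX.lindelofSpace
  obtain ⟨A, hA⟩ := exists_range_countableOrdinals (S := 𝒢)
    (let ⟨A, hA, _⟩ := h𝒢 ∅ isCompact_empty (empty_subset _); ⟨A, hA⟩)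
    ((Cardinal.mk_subtype_mono hc).trans (mk_countable_codes_le hCH hJ))
  have hA𝒢 : ∀ β, A β ∈ 𝒢 := fun β => hA ▸ mem_range_self β
  obtain ⟨ι⟩ : Nonempty (J ↪ CountableOrdinals.{u}) := by
    rwa [← Cardinal.mk_ord_toType ℵ₁] at hJ
  -- An increasing sequence of countable sets of coordinates exhausting `J`.
  let C : CountableOrdinals.{u} → Set J := fun δ =>
    {j | ι j < δ ∨ ∃ β < δ, ∃ a ∈ A β, ∃ p ∈ a, p.1 = j}
  have hCmono : Monotone C := by
    rintro δ ε h j (hj | ⟨β, hβ, hj⟩)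
    · exact Or.inl (hj.trans_le h)
    · exact Or.inr ⟨β, hβ.trans_le h, hj⟩
  have hCc : ∀ δ, (C δ).Countable := by
    intro δ
    have hIio : (Iio δ).Countable := (countable_Iic_countableOrdinals δ).mono Iio_subset_Iic_self
    have h1 : (ι ⁻¹' Iio δ).Countable := hIio.preimage ι.injective
    have h2 : (⋃ β ∈ Iio δ, ⋃ a ∈ A β, Prod.fst '' (a : Set (J × Bool))).Countable :=
      hIio.biUnion fun β _ => (hc _ (hA𝒢 β)).biUnion fun a _ =>
        (a.countable_toSet).image _
    refine (h1.union h2).mono ?_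
    rintro j (hj | ⟨β, hβ, a, ha, p, hp, rfl⟩)
    · exact Or.inl hj
    · exact Or.inr (mem_iUnion₂.2 ⟨β, hβ, mem_iUnion₂.2 ⟨a, ha, p, hp, rfl⟩⟩)
  have hCA : ∀ {β δ}, β < δ → ∀ a ∈ A β, ∀ p ∈ a, p.1 ∈ C δ := fun {β δ} h a ha p hp =>
    Or.inr ⟨β, h, a, ha, p, hp, rfl⟩
  have hCex : ∀ B : Set J, B.Countable → ∃ δ, B ⊆ C δ := by
    intro B hB
    obtain ⟨δ, hδ⟩ := exists_forall_lt_countableOrdinals (hB.image ι)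
    exact ⟨δ, fun j hj => Or.inl (hδ _ ⟨j, hj, rfl⟩)⟩
  let P : CountableOrdinals.{u} → Set (J → Bool) := fun δ =>
    {z | (C δ).domRestrict z ∉ upperTrace (fun j : C δ => b j) ∧ ∀ β < δ, z ∉ avoid (A β)}
  have hPL : ∀ δ, IsLindelof (P δ) := by
    intro δ
    have : Countable (C δ) := (hCc δ).to_subtype
    have h1 : P δ = (C δ).domRestrict (π := fun _ => Bool) ⁻¹' ((C δ).domRestrict '' P δ) := by
      refine subset_antisymm (subset_preimage_image _ _) ?_
      rintro w ⟨z, ⟨hz1, hz2⟩, hzw⟩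
      refine ⟨hzw ▸ hz1, fun β hβ hw => hz2 β hβ ?_⟩
      exact mem_avoid_of_restrict_eq (hCA hβ) hzw.symm hw
    rw [h1]
    exact isLindelof_preimage_of_compactSpace (Pi.continuous_domRestrict _) _
  obtain ⟨D, hD, hDc⟩ := hX.exists_countable_cover countable_Iic_countableOrdinals b hb
    (fun δ => avoid (A δ)) (fun δ => isGδ_avoid (hc _ (hA𝒢 δ))) (⋃ δ, P δ)
    (by
      refine disjoint_left.2 fun z hz hzN => ?_
      obtain ⟨δ, hδ⟩ := mem_iUnion.1 hz
      exact hδ.1 (restrict_mem_upperTrace _ hzN))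
    (by
      refine fun β => ⟨⋃ δ ∈ Iic β, P δ, (countable_Iic_countableOrdinals β).isLindelof_biUnion
        fun δ _ => hPL δ, ?_, iUnion₂_subset fun δ _ => subset_iUnion P δ⟩
      rintro z ⟨hz, hzβ⟩
      obtain ⟨δ, hδ⟩ := mem_iUnion.1 hz
      exact mem_iUnion₂.2 ⟨δ, not_lt.1 fun h => hδ.2 β h hzβ, hδ⟩)
    (by
      intro K hK hne hKP
      by_contra! hcon
      -- No relatively open part of `K` is contained in `upperTrace b`.
      have h1 : ∀ a : Finset (J × Bool), (cyl a ∩ K).Nonempty →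
          ∃ δ, ∃ z ∈ cyl a ∩ K, (C δ).domRestrict z ∉ upperTrace fun j : C δ => b j := by
        intro a ha
        have h2 : ¬ cyl a ∩ K ⊆ upperTrace b := by
          intro hsub
          obtain ⟨B, hB, hKB⟩ := h𝒢 _ (hK.inter_left (isClopen_cyl a).isClosed) hsub
          obtain ⟨β, rfl⟩ : B ∈ range A := hA ▸ hB
          exact hcon (cyl a) β (isClopen_cyl a).isOpen ha hKB
        obtain ⟨z, hz, hzN⟩ := not_subset.1 h2
        obtain ⟨B, hB, hzB⟩ := exists_countable_restrict_notMem_upperTrace hb hzN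
        obtain ⟨δ, hδ⟩ := hCex B hB
        exact ⟨δ, z, hz, fun h => hzB (restrict_mem_upperTrace_mono hδ h)⟩
      choose! f hf using h1
      -- Iterating `h3` gives a limit stage `δ` before which all the witnesses for cylinders over
      -- `C δ` have appeared.
      have h3 : ∀ ε, ∃ δ, ε < δ ∧ ∀ a : Finset (J × Bool), (∀ p ∈ a, p.1 ∈ C ε) → f a < δ := by
        intro ε
        have h4 : {a : Finset (J × Bool) | ∀ p ∈ a, p.1 ∈ C ε}.Countable := by
          have : (C ε ×ˢ (univ : Set Bool)).Countable := (hCc ε).prod (to_countable _)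
          refine ((countable_ofPred_finite_subset this).preimage
            Finset.coe_injective).mono fun a ha => ?_
          exact ⟨a.finite_toSet, fun p hp => ⟨ha p hp, trivial⟩⟩
        obtain ⟨δ, hδ⟩ := exists_forall_lt_countableOrdinals
          ((h4.image f).union (countable_singleton ε))
        exact ⟨δ, hδ _ (Or.inr rfl), fun a ha => hδ _ (Or.inl ⟨a, ha, rfl⟩)⟩
      choose g hg hgf using h3
      let s : ℕ → CountableOrdinals.{u} := fun n => g^[n] (Classical.arbitrary _)
      have hs : ∀ n, s (n + 1) = g (s n) := fun n => Function.iterate_succ_apply' g n _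
      have hsmono : Monotone s := monotone_nat_of_le_succ fun n => by
        rw [hs]; exact (hg _).le
      have hub : {δ | ∀ n, s n < δ}.Nonempty := by
        obtain ⟨δ, hδ⟩ := exists_forall_lt_countableOrdinals (countable_range s)
        exact ⟨δ, fun n => hδ _ ⟨n, rfl⟩⟩
      obtain ⟨δ, hδ, hmin⟩ : ∃ δ, (∀ n, s n < δ) ∧ ∀ ε < δ, ∃ n, ε ≤ s n := by
        refine ⟨wellFounded_lt.min _ hub, wellFounded_lt.min_mem _ hub, fun ε hε => ?_⟩
        by_contra! h
        exact wellFounded_lt.not_lt_min _ (show ε ∈ {δ | ∀ n, s n < δ} from h) hε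
      have hCs : ∀ j ∈ C δ, ∃ n, j ∈ C (s n) := by
        rintro j (hj | ⟨β, hβ, hj⟩)
        · obtain ⟨n, hn⟩ := hmin _ hj
          refine ⟨n + 1, Or.inl (hn.trans_lt ?_)⟩
          rw [hs]; exact hg _
        · obtain ⟨n, hn⟩ := hmin _ hβ
          refine ⟨n + 1, Or.inr ⟨β, hn.trans_lt ?_, hj⟩⟩
          rw [hs]; exact hg _
      have hfδ : ∀ a : Finset (J × Bool), (∀ p ∈ a, p.1 ∈ C δ) → f a < δ := by
        intro a ha
        have : ∃ n, ∀ p ∈ a, p.1 ∈ C (s n) := by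
          choose! m hm using fun p (hp : p ∈ a) => hCs p.1 (ha p hp)
          exact ⟨a.sup m, fun p hp => hCmono (hsmono (Finset.le_sup hp)) (hm p hp)⟩
        obtain ⟨n, hn⟩ := this
        have h5 := hgf (s n) a hn
        rw [← hs] at h5
        exact h5.trans (hδ _)
      -- The Baire category theorem in the projection of `K` to the coordinates in `C δ`.
      have : Countable (C δ) := (hCc δ).to_subtype
      have hcont : Continuous ((C δ).domRestrict (π := fun _ => Bool)) :=
        Pi.continuous_domRestrict _
      obtain ⟨S, hS, hScl, hSN⟩ := hX.exists_upperTrace_eq_sUnion hCH (fun j : C δ => b j)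
        fun j => hb j
      have hIio : (Iio δ).Countable :=
        (countable_Iic_countableOrdinals δ).mono Iio_subset_Iic_self
      obtain ⟨p, ⟨z, hzK, rfl⟩, hp⟩ := (hK.image hcont).exists_notMem_of_countable
        (hne.image _) (hS.union (hIio.image fun β => (C δ).domRestrict '' avoid (A β)))
        (by
          rintro F (hF | ⟨β, -, rfl⟩)
          · exact hScl F hF
          · exact hcont.isClosedMap _ (isClosed_avoid _))
        (by
          rintro F (hF | ⟨β, hβ, rfl⟩) O hO ⟨_, hzO, z, hzK, rfl⟩
          · obtain ⟨a, ha, hza, haO⟩ := exists_cyl_subset_preimage_restrict hO hzO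
            obtain ⟨w, hw, hwN⟩ := hf a ⟨z, hza, hzK⟩
            refine ⟨_, ⟨haO hw.1, w, hw.2, rfl⟩, fun hwF => hwN ?_⟩
            refine restrict_mem_upperTrace_mono (hCmono (hfδ a ha).le) ?_
            rw [hSN]
            exact ⟨F, hF, hwF⟩
          · obtain ⟨w, hw, hwA⟩ := not_subset.1
              (hcon _ β (hO.preimage hcont) ⟨z, hzO, hzK⟩)
            refine ⟨_, ⟨hw.1, w, hw.2, rfl⟩, ?_⟩
            rintro ⟨v, hv, hvw⟩
            exact hwA (mem_avoid_of_restrict_eq (hCA hβ) hvw hv))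
      refine disjoint_left.1 hKP hzK (mem_iUnion.2 ⟨δ, fun hzN => ?_, fun β hβ hzA => ?_⟩)
      · rw [hSN] at hzN
        obtain ⟨F, hF, hzF⟩ := hzN
        exact hp F (Or.inl hF) hzF
      · exact hp _ (Or.inr ⟨β, hβ, rfl⟩) ⟨z, hzA, rfl⟩)
  refine ⟨A '' D, ?_, hD.image _, ?_⟩
  · rintro _ ⟨β, -, rfl⟩
    exact hA𝒢 β
  · rwa [biUnion_image]

/-! ### Countable powers -/

/-- Under the continuum hypothesis, if `X` is productively quasi-Lindelöf then every cover of
`X^ω` by at most `𝔠` basic open sets `∏ i, V k i` has a countable subcover. -/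
theorem ProductivelyQuasiLindelof.exists_countable_subcover_pi (hCH : ContinuumHypothesis)
    {X : Type u} [TopologicalSpace X] (hX : ProductivelyQuasiLindelof X) {I : Type u}
    (hI : #I ≤ 𝔠) (V : I → ℕ → Set X) (hV : ∀ k i, IsOpen (V k i))
    (hfin : ∀ k, {i | V k i ≠ univ}.Finite) (hcov : ∀ x : ℕ → X, ∃ k, ∀ i, x i ∈ V k i) :
    ∃ t : Set I, t.Countable ∧ ∀ x : ℕ → X, ∃ k ∈ t, ∀ i, x i ∈ V k i := by
  classical
  by_contra hcon
  let b : I × ℕ → Set X := fun j => V j.1 j.2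
  let e : X → I × ℕ → Bool := fun x j => decide (x ∈ b j)
  have heN : ∀ x, e x ∈ upperTrace b := fun x => ⟨x, fun j hj => by simpa [e] using hj⟩
  let Cov : Set (ℕ → X) → Prop := fun S =>
    ∃ t : Set I, t.Countable ∧ ∀ x ∈ S, ∃ k ∈ t, ∀ i, x i ∈ V k i
  let box : ℕ → (ℕ → Set (Finset ((I × ℕ) × Bool))) → Set (ℕ → X) := fun n A =>
    {x | ∀ i < n, e (x i) ∈ avoid (A i)}
  -- No `Gδ` neighbourhood of `K 0 × ⋯ × K (n - 1)` gives a countably covered box.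
  let Bad : ℕ → (ℕ → Set (I × ℕ → Bool)) → Prop := fun n K =>
    ∀ A : ℕ → Set (Finset ((I × ℕ) × Bool)), (∀ i < n, (A i).Countable ∧ K i ⊆ avoid (A i)) →
      ¬ Cov (box n A)
  have hJ : #(I × ℕ) ≤ ℵ₁ := by
    rw [hCH.aleph_one_eq, Cardinal.mk_prod, Cardinal.lift_uzero, Cardinal.mk_nat,
      Cardinal.lift_aleph0]
    exact (mul_le_mul' hI le_rfl).trans_eq Cardinal.continuum_mul_aleph0
  have step : ∀ n K, Bad n K → ∃ K', (IsCompact K' ∧ K' ⊆ upperTrace b) ∧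
      Bad (n + 1) (Function.update K n K') := by
    intro n K hbad
    by_contra! hno
    let 𝒢 : Set (Set (Finset ((I × ℕ) × Bool))) := {B | ∃ A, A n = B ∧
      (∀ i < n, K i ⊆ avoid (A i)) ∧ (∀ i ≤ n, (A i).Countable) ∧ Cov (box (n + 1) A)}
    obtain ⟨D, hD𝒢, hD, hDc⟩ := hX.exists_countable_avoid_cover hCH hJ b (fun j => hV _ _) 𝒢
      (by rintro _ ⟨A, rfl, -, h, -⟩; exact h n le_rfl)
      (by
        intro K' hK' hK'N
        have := hno K' ⟨hK', hK'N⟩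
        simp only [Bad, not_forall, not_not] at this
        obtain ⟨A, hA, hAc⟩ := this
        refine ⟨A n, ⟨A, rfl, fun i hi => ?_, fun i hi => (hA i (by omega)).1, hAc⟩, ?_⟩
        · simpa [hi.ne] using (hA i (by omega)).2
        · simpa using (hA n (by omega)).2)
    have hDA : ∀ B ∈ D, ∃ A, A n = B ∧ (∀ i < n, K i ⊆ avoid (A i)) ∧
        (∀ i ≤ n, (A i).Countable) ∧ Cov (box (n + 1) A) := fun B hB => hD𝒢 hB
    choose! A hAn hAK hAc hAcov using hDA
    choose! t ht htc using hAcov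
    refine hbad (fun i => ⋃ B ∈ D, A B i) (fun i hi => ⟨hD.biUnion fun B hB =>
      hAc B hB i hi.le, fun z hz a ha => ?_⟩) ⟨⋃ B ∈ D, t B, hD.biUnion fun B hB => ht B hB,
      fun x hx => ?_⟩
    · obtain ⟨B, hB, haB⟩ := mem_iUnion₂.1 ha
      exact hAK B hB i hi hz a haB
    · obtain ⟨B, hB, hxB⟩ := mem_iUnion₂.1 (hDc (heN (x n)))
      obtain ⟨k, hk, hxk⟩ := htc B hB x fun i hi => by
        rcases Nat.lt_succ_iff_lt_or_eq.1 hi with hi | rfl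
        · exact fun a ha => hx i hi a (mem_iUnion₂.2 ⟨B, hB, ha⟩)
        · rwa [hAn B hB]
      exact ⟨k, mem_iUnion₂.2 ⟨B, hB, hk⟩, hxk⟩
  choose! κ hκ hκbad using step
  let f : ℕ → ℕ → Set (I × ℕ → Bool) := fun n =>
    n.rec (fun _ => ∅) fun n K => Function.update K n (κ n K)
  have hf : ∀ n, Bad n (f n) := by
    intro n
    induction n with
    | zero =>
      rintro A - ⟨t, ht, htc⟩
      exact hcon ⟨t, ht, fun x => htc x fun i hi => absurd hi (Nat.not_lt_zero i)⟩
    | succ n ih => exact hκbad n _ ih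
  let K : ℕ → Set (I × ℕ → Bool) := fun i => κ i (f i)
  have hfK : ∀ n, ∀ i < n, f n i = K i := by
    intro n
    induction n with
    | zero => intro i hi; exact absurd hi (Nat.not_lt_zero i)
    | succ n ih =>
      intro i hi
      rcases Nat.lt_succ_iff_lt_or_eq.1 hi with hi | rfl
      · exact (Function.update_of_ne hi.ne _ _).trans (ih i hi)
      · exact Function.update_self ..
  have hKbad : ∀ n A, (∀ i < n, (A i).Countable ∧ K i ⊆ avoid (A i)) → ¬ Cov (box n A) :=
    fun n A hA => hf n A fun i hi => by rw [hfK n i hi]; exact hA i hi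
  have hKc : ∀ i, IsCompact (K i) := fun i => (hκ i _ (hf i)).1
  have hKN : ∀ i, K i ⊆ upperTrace b := fun i => (hκ i _ (hf i)).2
  have hKne : ∀ i, (K i).Nonempty := by
    intro i
    by_contra hemp
    rw [not_nonempty_iff_eq_empty] at hemp
    refine hKbad (i + 1) (fun m => if m = i then {∅} else ∅) (fun m _ => ?_)
      ⟨∅, countable_empty, fun x hx => ?_⟩
    · by_cases hm : m = i
      · subst hm; simp [hemp]
      · simp [hm, avoid]
    · have := hx i (Nat.lt_succ_self i)
      simp [avoid, cyl] at this
  -- Finitely many `V k` cover the compact product of the `K i`, in the sense of the cube.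
  let U : I → Set (ℕ → I × ℕ → Bool) := fun k => {y | ∀ i ∈ {i | V k i ≠ univ}, y i (k, i) = true}
  obtain ⟨t, htc⟩ := (isCompact_univ_pi hKc).elim_finite_subcover U
    (fun k => by
      have : U k = ⋂ i ∈ {i | V k i ≠ univ}, {y | y i (k, i) = true} := by
        ext y; simp [U]
      rw [this]
      exact (hfin k).isOpen_biInter fun i _ =>
        (isOpen_discrete {true}).preimage
          (f := fun y : ℕ → I × ℕ → Bool => y i (k, i)) (by fun_prop))
    (by
      intro y hy
      choose x hx using fun i => hKN i (hy i trivial)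
      obtain ⟨k, hk⟩ := hcov x
      exact mem_iUnion.2 ⟨k, fun i _ => hx i (k, i) (hk i)⟩)
  obtain ⟨n, hn⟩ : ∃ n, ∀ k ∈ t, ∀ i, V k i ≠ univ → i < n := by
    obtain ⟨n, hn⟩ := (t.finite_toSet.biUnion fun k _ => hfin k).bddAbove
    exact ⟨n + 1, fun k hk i hi => Nat.lt_succ_of_le (hn (mem_iUnion₂.2 ⟨k, hk, hi⟩))⟩
  -- The `Gδ` neighbourhood of `K i` remembers only the coordinates `(k, i)` with `k ∈ t`.
  let s : ℕ → Finset (I × ℕ) := fun i => t.image fun k => (k, i)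
  let A : ℕ → Set (Finset ((I × ℕ) × Bool)) := fun i =>
    {a | (∀ p ∈ a, p.1 ∈ s i) ∧ Disjoint (K i) (cyl a)}
  refine hKbad n A (fun i _ => ⟨?_, fun z hz a ha => disjoint_left.1 ha.2 hz⟩)
    ⟨t, t.countable_toSet, fun x hx => ?_⟩
  · refine ((Finset.finite_toSet ((s i ×ˢ (Finset.univ : Finset Bool)).powerset)).subset
      fun a ha => ?_).countable
    refine Finset.mem_coe.2 (Finset.mem_powerset.2 fun p hp => ?_)
    exact Finset.mem_product.2 ⟨ha.1 p hp, Finset.mem_univ _⟩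
  · have : ∀ i, ∃ y ∈ K i, i < n → ∀ j ∈ s i, y j = e (x i) j := by
      intro i
      by_cases hi : i < n
      · have h1 : (s i).image (fun j => (j, e (x i) j)) ∉ A i := by
          refine fun hmem => hx i hi _ hmem fun p hp => ?_
          obtain ⟨j, -, rfl⟩ := Finset.mem_image.1 hp
          rfl
        have h2 : ¬ Disjoint (K i) (cyl ((s i).image fun j => (j, e (x i) j))) := by
          refine fun hd => h1 ⟨fun p hp => ?_, hd⟩
          obtain ⟨j, hj, rfl⟩ := Finset.mem_image.1 hp
          exact hj
        obtain ⟨y, hyK, hy⟩ := not_disjoint_iff.1 h2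
        exact ⟨y, hyK, fun _ j hj => hy (j, e (x i) j) (Finset.mem_image_of_mem _ hj)⟩
      · obtain ⟨y, hy⟩ := hKne i
        exact ⟨y, hy, fun h => absurd h hi⟩
    choose y hyK hy using this
    obtain ⟨k, hk, hyk⟩ := mem_iUnion₂.1 (htc (show y ∈ univ.pi K from fun i _ => hyK i))
    refine ⟨k, hk, fun i => ?_⟩
    by_cases hi : V k i = univ
    · rw [hi]; trivial
    · have h1 := hyk i hi
      rw [hy i (hn k hk i hi) (k, i) (Finset.mem_image_of_mem _ hk)] at h1
      simpa [e, b] using h1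

/-! ### Reduction to covers of size continuum -/

theorem ProductivelyQuasiLindelof.of_isClosed {X : Type u} [TopologicalSpace X]
    (hX : ProductivelyQuasiLindelof X) {F : Set X} (hF : IsClosed F) :
    ProductivelyQuasiLindelof F := by
  intro Y _ hY
  have := (quasiLindelof_iff_lindelofSpace _).1 (hX Y hY)
  have h : Topology.IsClosedEmbedding (Prod.map ((↑) : F → X) (id : Y → Y)) :=
    hF.isClosedEmbedding_subtypeVal.prodMap .id
  exact (quasiLindelof_iff_lindelofSpace _).2
    ⟨by simpa using h.isLindelof_preimage isLindelof_univ⟩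

/-- Well-founded trees standing for the terms built from a constant and `𝔠` many operations of
countable arity: `none` is the constant, and `some (r, i)` an operation taking `ℕ × ℕ` arguments.
Such an operation is given, for each `n`, a point of `X^ω` (its `n`-th row of arguments); `r n`
selects a member of the point-`𝔠` family at that point, and the value is the `i`-th coordinate of a
point outside all the selected members. -/
abbrev ClosureTree : Type :=
  WType (α := Option ((ℕ → ℕ → Bool) × ℕ)) fun o => {_n : ℕ × ℕ // o.isSome}

theorem mk_closureTree_le : #ClosureTree ≤ 𝔠 := by
  refine WType.cardinalMk_le_of_le ?_
  refine (Cardinal.sum_le_sum _ (fun _ => 𝔠) fun o => ?_).trans ?_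
  · refine (Cardinal.power_le_power_left Cardinal.continuum_ne_zero
      (Cardinal.mk_le_aleph0)).trans_eq Cardinal.continuum_power_aleph0
  · rw [Cardinal.sum_const, Cardinal.lift_id, Cardinal.lift_id]
    refine (mul_le_mul' (?_ : _ ≤ 𝔠) le_rfl).trans_eq Cardinal.continuum_mul_self
    rw [Cardinal.mk_option]
    simpa [Cardinal.continuum_power_aleph0, Cardinal.continuum_mul_aleph0] using
      (Cardinal.continuum_add_nat 1).le

/-- If `𝒲` is point-`𝔠` and no countable subfamily of `𝒲` covers `X^ω`, then there is `Y ⊆ X`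
such that at most `𝔠` members of `𝒲` meet `Y^ω` and no countable subfamily of `𝒲` consisting of
such members covers `Y^ω`. -/
theorem exists_small_uncovered {X : Type u} {𝒲 : Set (Set (ℕ → X))}
    (hp : IsPointFamily 𝔠 𝒲) (hcov : ∀ t ⊆ 𝒲, t.Countable → ⋃₀ t ≠ univ) :
    ∃ Y : Set X, #{W // W ∈ 𝒲 ∧ ∃ x ∈ W, ∀ i, x i ∈ Y} ≤ 𝔠 ∧
      ∀ t ⊆ {W | W ∈ 𝒲 ∧ ∃ x ∈ W, ∀ i, x i ∈ Y}, t.Countable →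
        ∃ x : ℕ → X, (∀ i, x i ∈ Y) ∧ x ∉ ⋃₀ t := by
  classical
  have h1 : ∀ w : ℕ → Set (ℕ → X), ∃ x, (∀ n, w n ∈ 𝒲) → ∀ n, x ∉ w n := by
    intro w
    by_cases hw : ∀ n, w n ∈ 𝒲
    · obtain ⟨x, hx⟩ := (ne_univ_iff_exists_notMem _).1
        (hcov (range w) (range_subset_iff.2 hw) (countable_range w))
      exact ⟨x, fun _ n hxn => hx ⟨w n, ⟨n, rfl⟩, hxn⟩⟩
    · obtain ⟨x, -⟩ := (ne_univ_iff_exists_notMem _).1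
        (hcov ∅ (empty_subset _) countable_empty)
      exact ⟨x, fun h => absurd h hw⟩
  choose f hf using h1
  have h2 : ∀ x : ℕ → X, ∃ g : (ℕ → Bool) → Set (ℕ → X), ∀ W ∈ 𝒲, x ∈ W → ∃ r, g r = W := by
    intro x
    have h3 : (𝔠 : Cardinal.{u}) = #(ULift.{u} (ℕ → Bool)) := by simp
    have h4 := hp x
    rw [h3] at h4
    obtain ⟨φ⟩ := h4
    by_cases hne : Nonempty {W // W ∈ 𝒲 ∧ x ∈ W}
    · refine ⟨fun r => (Function.invFun φ ⟨r⟩).1, fun W hW hx => ⟨(φ ⟨W, hW, hx⟩).down, ?_⟩⟩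
      exact congrArg Subtype.val (Function.leftInverse_invFun φ.injective ⟨W, hW, hx⟩)
    · exact ⟨fun _ => ∅, fun W hW hx => absurd ⟨⟨W, hW, hx⟩⟩ hne⟩
  choose g hg using h2
  -- `g x` enumerates the members of `𝒲` at `x`, and `f w` is a point outside all `w n`.
  obtain ⟨x₀, -⟩ := (ne_univ_iff_exists_notMem _).1 (hcov ∅ (empty_subset _) countable_empty)
  let ev : ClosureTree → X := fun T => T.elim X fun
    | ⟨none, _⟩ => x₀ 0
    | ⟨some (r, i), c⟩ => f (fun n => g (fun m => c ⟨(n, m), rfl⟩) (r n)) i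
  have hev : ∀ (r : ℕ → ℕ → Bool) (i : ℕ) (c : ℕ → ℕ → ClosureTree),
      ev (.mk (some (r, i)) fun q => c q.1.1 q.1.2) =
        f (fun n => g (fun m => ev (c n m)) (r n)) i := fun r i c => rfl
  have hlift : ∀ x : ℕ → X, (∀ i, x i ∈ range ev) →
      ∃ c : ℕ → ClosureTree, (fun m => ev (c m)) = x := by
    intro x hx
    choose c hc using hx
    exact ⟨c, funext hc⟩
  refine ⟨range ev, ?_, ?_⟩
  · let G : (ℕ → ClosureTree) × (ℕ → Bool) → Set (ℕ → X) := fun q => g (fun m => ev (q.1 m)) q.2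
    have hsub : {W | W ∈ 𝒲 ∧ ∃ x ∈ W, ∀ i, x i ∈ range ev} ⊆ range G := by
      rintro W ⟨hW, x, hxW, hx⟩
      obtain ⟨c, rfl⟩ := hlift x hx
      obtain ⟨r, hr⟩ := hg _ W hW hxW
      exact ⟨(c, r), hr⟩
    have h5 : #((ℕ → ClosureTree) × (ℕ → Bool)) ≤ 𝔠 := by
      rw [Cardinal.mk_prod, Cardinal.lift_id, Cardinal.lift_id]
      refine (mul_le_mul' (?_ : _ ≤ 𝔠) (?_ : _ ≤ 𝔠)).trans_eq Cardinal.continuum_mul_self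
      · rw [← Cardinal.power_def, Cardinal.mk_nat]
        exact (Cardinal.power_le_power_right mk_closureTree_le).trans_eq
          Cardinal.continuum_power_aleph0
      · simp
    have h6 := Cardinal.mk_range_le_lift (f := G)
    have h7 : Cardinal.lift.{0} #(range G) ≤ 𝔠 := by
      refine h6.trans ?_
      rwa [Cardinal.lift_le_continuum]
    rw [Cardinal.lift_uzero] at h7
    exact (Cardinal.mk_le_mk_of_subset hsub).trans h7
  · intro t ht htc
    rcases t.eq_empty_or_nonempty with rfl | hne
    · exact ⟨fun _ => x₀ 0, fun i => ⟨.mk none fun q => absurd q.2 (by simp), rfl⟩, by simp⟩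
    · obtain ⟨w, rfl⟩ := htc.exists_eq_range hne
      have h8 : ∀ n, ∃ (c : ℕ → ClosureTree) (r : ℕ → Bool), g (fun m => ev (c m)) r = w n := by
        intro n
        obtain ⟨hW, x, hxW, hx⟩ := ht ⟨n, rfl⟩
        obtain ⟨c, rfl⟩ := hlift x hx
        obtain ⟨r, hr⟩ := hg _ _ hW hxW
        exact ⟨c, r, hr⟩
      choose c r hcr using h8
      refine ⟨f w, fun i => ⟨.mk (some (r, i)) fun q => c q.1.1 q.1.2, ?_⟩, ?_⟩
      · rw [hev]; simp only [hcr]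
      · rintro ⟨_, ⟨n, rfl⟩, hn⟩
        exact hf w (fun n => (ht ⟨n, rfl⟩).1) n hn

theorem theorem5p2 (hCH : ContinuumHypothesis) (X : Type u) [TopologicalSpace X]
    (hX : ProductivelyQuasiLindelof X)
    (href : ∀ 𝒰 : Set (Set (ℕ → X)), IsCoverByOpens 𝒰 →
      ∃ 𝒲 : Set (Set (ℕ → X)), IsRefinement 𝒲 𝒰 ∧ (∀ W ∈ 𝒲, IsBasicOpen W) ∧
        IsPointFamily 𝔠 𝒲) :
    PowerfullyQuasiLindelof X := by
  intro 𝒰 h𝒰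
  obtain ⟨𝒲, ⟨hcov, hsub⟩, hbasic, hpt⟩ := href 𝒰 h𝒰
  -- A countable subcover of `𝒲` yields one of `𝒰`.
  suffices h : ∃ t ⊆ 𝒲, t.Countable ∧ ⋃₀ t = univ by
    obtain ⟨t, ht, htc, htu⟩ := h
    choose! u hu hWu using hsub
    refine ⟨u '' t, ?_, htc.image u, eq_univ_of_forall fun x => ?_⟩
    · rintro _ ⟨W, hW, rfl⟩
      exact hu W (ht hW)
    · obtain ⟨W, hW, hx⟩ := (htu ▸ mem_univ x : x ∈ ⋃₀ t)
      exact ⟨u W, ⟨W, hW, rfl⟩, hWu W (ht hW) hx⟩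
  by_contra! hcon
  obtain ⟨Y, hYc, hY⟩ := exists_small_uncovered hpt hcon
  let I := {W // W ∈ 𝒲 ∧ ∃ x ∈ W, ∀ i, x i ∈ Y}
  choose V hVo hVf hWV using fun W : I => hbasic W W.2.1
  -- The members of `𝒲` meeting `Y^ω` cover the power of the closure of `Y`.
  obtain ⟨t, ht, htc⟩ := (hX.of_isClosed (isClosed_closure (s := Y))).exists_countable_subcover_pi
    hCH (I := I) hYc (fun W i => ((↑) : closure Y → X) ⁻¹' V W i)
    (fun W i => (hVo W i).preimage continuous_subtype_val)
    (fun W => (hVf W).subset fun i hi h => hi (by rw [h, preimage_univ]))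
    (by
      intro x
      obtain ⟨W, hW, hx⟩ := (hcov ▸ mem_univ (fun i => (x i : X)) : (fun i => (x i : X)) ∈ ⋃₀ 𝒲)
      obtain ⟨O, hO, -, rfl⟩ := hbasic W hW
      choose y hyO hyY using fun i => mem_closure_iff.1 (x i).2 (O i) (hO i) (hx i)
      let W' : I := ⟨_, hW, y, hyO, hyY⟩
      have hx' : (fun i => (x i : X)) ∈ W'.1 := hx
      rw [hWV W'] at hx'
      exact ⟨W', hx'⟩)
  obtain ⟨x, hxY, hx⟩ := hY ((↑) '' t) (by rintro _ ⟨W, -, rfl⟩; exact W.2) (ht.image _)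
  obtain ⟨W, hW, hxW⟩ := htc fun i => ⟨x i, subset_closure (hxY i)⟩
  refine hx ⟨W, ⟨W, hW, rfl⟩, ?_⟩
  rw [hWV W]
  exact hxW
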